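/- **Setting.** Let $X_1,X_2$ be countable (finite or infinite) sets. A *graph* over $X$ is a pair $(b,c)$ where $b:X\times X\to[0,\infty)$ is symmetric, vanishes on the diagonal and satisfies $\sum_y b(x,y)<\infty$ for every $x$, and $c:X\to[0,\infty)$. It is *connected* if any two vertices can be joined by a path along pairs with $b>0$. Its formal Laplacian is $$\mathcal L f(x)=\sum_{y}b(x,y)(f(x)-f(y))+c(x)f(x)$$ on $\mathcal F=\{f:X\to\mathbb R:\ \sum_y b(x,y)|f(y)|<\infty\text{ for all }x\}$, and its generalized form is $$\mathcal Q(f)=\tfrac12\sum_{x,y}b(x,y)|f(x)-f(y)|^2+\sum_x c(x)|f(x)|^2\in[0,\infty],$$ polarized to $\mathcal Q(f,g)$ on $\mathcal D=\{\mathcal Q<\infty\}$. Let $m:X\to(0,\infty)$, and let $\ell^2(X,m)$ be the real Hilbert space with scalar product $\langle u,v\rangle=\sum_x u(x)v(x)m(x)$. A *Dirichlet form associated to $(b,c)$ over $(X,m)$* is a closed non-negative symmetric form $Q$ on $\ell^2(X,m)$ with $C_c(X)\subseteq D(Q)\subseteq\mathcal D\cap\ell^2(X,m)$ and $Q=\mathcal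 Q$ on $D(Q)$ such that $C\circ f\in D(Q)$ and $Q(C\circ f)\le Q(f)$ for all $f\in D(Q)$ and all normal contractions $C:\mathbb R\to\mathbb R$ (that is, $|C(p)|\le|p|$ and $|C(p)-C(q)|\le|p-q|$). Here $C_c(X)$ denotes the finitely supported functions. The *generator* $L$ of $Q$ is the self-adjoint operator with $D(L)=\{f\in D(Q):\exists w\in\ell^2(X,m)\ \forall g\in D(Q)\ Q(f,g)=\langle w,g\rangle\}$ and $Lf=w$. An *order isomorphism* $U:\ell^2(X_1,m_1)\to\ell^2(X_2,m_2)$ is a linear bijection such that $U$ and $U^{-1}$ map non-negative functions to non-negative functions. For such a $U$ there are a unique bijection $\tau:X_2\to X_1$ and a unique function $h:X_2\to(0,\infty)$ (the bijection and the scaling associated to $U$) such that $Uf=h\cdot(f\circ\tau)$ for all $f$. The order isomorphism $U$ *intertwines* $L_1$ and $L_2$ if $U D(L_1)=D(L_2)$ and $UL_1f=L_2Uf$ for all $f\in D(L_1)$. **Theorem.** For $i=1,2$ let $Q_i$ be a Dirichlet form associated to the graph $(b_i,c_i)$ over $(X_i,m_i)$, with generator $L_i$, and let $(b_1,c_1)$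 be connected. Let $U:\ell^2(X_1,m_1)\to\ell^2(X_2,m_2)$ be an order isomorphism intertwining $L_1$ and $L_2$, with associated bijection $\tau$ and scaling $h$. Then $U D(Q_1)=D(Q_2)$, and there is a constant $\beta>0$ such that $$Q_1(f,g)=\beta\,Q_2(Uf,Ug)\qquad\text{for all } f,g\in D(Q_1).$$ Moreover, $h$ belongs to the domain $\mathcal F_2$ of the formal Laplacian $\mathcal L_2$ of $(b_2,c_2)$, and for all $w,x,y,z\in X_2$ $$m_1(\tau(w))=\beta h(w)^2m_2(w),\qquad b_1(\tau(x),\tau(y))=\beta h(x)h(y)\,b_2(x,y),\qquad c_1(\tau(z))=\beta h(z)\,\mathcal L_2h(z).$$ -/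

import Mathlib

open scoped ENNReal Topology

namespace GraphDiffusion

/-- A graph `(b, c)` over `X`: a symmetric edge weight `b : X × X → [0, ∞)` with zero diagonal and
summable rows, together with a killing term `c : X → [0, ∞)`. -/
structure WGraph (X : Type*) where
  b : X → X → ℝ
  c : X → ℝ
  b_nonneg : ∀ x y, 0 ≤ b x y
  b_symm : ∀ x y, b x y = b y x
  b_diag : ∀ x, b x x = 0
  b_summable : ∀ x, Summable (b x)
  c_nonneg : ∀ x, 0 ≤ c x

/-- A measure of full support on the discrete set `X`, given by its weights `m : X → (0, ∞)`. -/
structure FullMeasure (X : Type*) where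
  weight : X → ℝ
  pos : ∀ x, 0 < weight x

instance {X : Type*} : CoeFun (FullMeasure X) (fun _ => X → ℝ) := ⟨FullMeasure.weight⟩

section Graphs

variable {X : Type*} (G : WGraph X)

/-- The underlying simple graph: `x ∼ y` if and only if `b x y > 0`. -/
def WGraph.simpleGraph : SimpleGraph X where
  Adj x y := 0 < G.b x y
  symm := ⟨fun x y h => by rw [G.b_symm y x]; exact h⟩
  loopless := ⟨fun x h => by rw [G.b_diag x] at h; exact lt_irrefl _ h⟩

/-- Any two vertices are joined by a path (of pairwise distinct vertices). -/
def WGraph.IsConnected : Prop :=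
  ∀ x y : X, ∃ p : G.simpleGraph.Walk x y, p.IsPath

/-- The domain `ℱ` of the formal Laplacian: `∑ y, b x y * |f y| < ∞` for all `x`. -/
def WGraph.formalDomain : Set (X → ℝ) :=
  {f | ∀ x, Summable fun y => G.b x y * |f y|}

/-- The formal Laplacian `ℒ f x = ∑ y, b x y * (f x - f y) + c x * f x`, meaningful for `f ∈ ℱ`. -/
noncomputable def WGraph.formalLaplacian (f : X → ℝ) (x : X) : ℝ :=
  (∑' y, G.b x y * (f x - f y)) + G.c x * f x

/-- The generalized form `𝒬 : C(X) → [0, ∞]`. -/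
noncomputable def WGraph.energy (f : X → ℝ) : ℝ≥0∞ :=
  (1 / 2) * (∑' p : X × X, ENNReal.ofReal (G.b p.1 p.2 * |f p.1 - f p.2| ^ 2))
    + ∑' x, ENNReal.ofReal (G.c x * |f x| ^ 2)

/-- The polarized generalized form `𝒬(f, g)`; both sums converge absolutely if `f` and `g` have
finite energy. -/
noncomputable def WGraph.energyBilin (f g : X → ℝ) : ℝ :=
  (1 / 2) * (∑' p : X × X, G.b p.1 p.2 * ((f p.1 - f p.2) * (g p.1 - g p.2)))
    + ∑' x, G.c x * (f x * g x)

end Graphs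

section Ell2

variable {X : Type*} (m : FullMeasure X)

/-- The space `ℓ²(X, m)` of real functions with `∑ x, f x ^ 2 * m x < ∞`. -/
def ell2 : Submodule ℝ (X → ℝ) where
  carrier := {f | Summable fun x => f x ^ 2 * m x}
  zero_mem' := by simp
  add_mem' := by
    intro f g hf hg
    refine Summable.of_nonneg_of_le (fun x => mul_nonneg (sq_nonneg _) (m.pos x).le)
      (fun x => ?_) ((hf.mul_left 2).add (hg.mul_left 2))
    have := mul_nonneg (sq_nonneg (f x - g x)) (m.pos x).le
    simp only [Pi.add_apply]
    nlinarith
  smul_mem' := by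
    intro a f hf
    have := Summable.mul_left (a ^ 2) hf
    refine this.congr (fun x => ?_)
    simp only [Pi.smul_apply, smul_eq_mul]
    ring

/-- The scalar product `⟨u, v⟩ = ∑ x, u x * v x * m x` of `ℓ²(X, m)`. -/
noncomputable def ell2Inner (u v : ell2 m) : ℝ :=
  ∑' x, (u : X → ℝ) x * (v : X → ℝ) x * m x

theorem ell2_summable_mul (u v : ell2 m) :
    Summable fun x => (u : X → ℝ) x * (v : X → ℝ) x * m x := by
  refine Summable.of_norm_bounded (Summable.add u.2 v.2) (fun x => ?_)
  rw [Real.norm_eq_abs, abs_mul, abs_mul, abs_of_pos (m.pos x), ← add_mul]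
  refine mul_le_mul_of_nonneg_right ?_ (m.pos x).le
  nlinarith [sq_nonneg (|(u : X → ℝ) x| - |(v : X → ℝ) x|), sq_abs ((u : X → ℝ) x),
    sq_abs ((v : X → ℝ) x), abs_nonneg ((u : X → ℝ) x), abs_nonneg ((v : X → ℝ) x)]

theorem ell2_of_finite {f : X → ℝ} (hf : (Function.support f).Finite) : f ∈ ell2 m := by
  refine summable_of_hasFiniteSupport (hf.subset fun x hx => ?_)
  intro h
  exact hx (by simp [h])

/-- The characteristic function `1_x` as an element of `ℓ²(X, m)`. -/
noncomputable def delta (x : X) : ell2 m :=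
  ⟨Set.indicator {x} 1, ell2_of_finite m
    ((Set.finite_singleton x).subset Set.support_indicator_subset)⟩

theorem delta_self (x : X) : (delta m x : X → ℝ) x = 1 := by simp [delta]

theorem delta_ne {x y : X} (h : y ≠ x) : (delta m x : X → ℝ) y = 0 := by simp [delta, h]

end Ell2

/-- A closed non-negative symmetric form on `ℓ²(X, m)`. Closed means that the domain is complete
for the form norm `(Q u + ‖u‖ ^ 2) ^ (1 / 2)`. -/
structure ClosedForm {X : Type*} (m : FullMeasure X) where
  domain : Submodule ℝ (ell2 m)
  bilin : LinearMap.BilinForm ℝ domain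
  symm : ∀ u v, bilin u v = bilin v u
  nonneg : ∀ u, 0 ≤ bilin u u
  closed : ∀ u : ℕ → domain,
    (∀ ε > 0, ∃ N, ∀ i ≥ N, ∀ j ≥ N,
      bilin (u i - u j) (u i - u j) + ell2Inner m ↑(u i - u j) ↑(u i - u j) < ε) →
    ∃ v : domain, Filter.Tendsto
      (fun n => bilin (u n - v) (u n - v) + ell2Inner m ↑(u n - v) ↑(u n - v))
      Filter.atTop (𝓝 0)

/-- `C : ℝ → ℝ` is a normal contraction. -/
def IsNormalContraction (C : ℝ → ℝ) : Prop :=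
  (∀ p, |C p| ≤ |p|) ∧ ∀ p q, |C p - C q| ≤ |p - q|

section Forms

variable {X : Type*} {m : FullMeasure X}

/-- `Q` is a form associated to the graph `G` over `(X, m)`: `C_c(X) ⊆ D(Q) ⊆ 𝒟 ∩ ℓ²(X, m)`, and
`Q` is the restriction of `𝒬` to `D(Q)`. -/
structure ClosedForm.IsAssociated (Q : ClosedForm m) (G : WGraph X) : Prop where
  finite_support_mem : ∀ f : ell2 m, (Function.support (f : X → ℝ)).Finite → f ∈ Q.domain
  energy_lt_top : ∀ f ∈ Q.domain, G.energy (f : X → ℝ) < ∞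
  eq_energyBilin : ∀ u v : Q.domain,
    Q.bilin u v = G.energyBilin ((u : ell2 m) : X → ℝ) ((v : ell2 m) : X → ℝ)

/-- `Q (C f) ≤ Q f` for all `f ∈ D(Q)` and all normal contractions `C` (in particular
`C f ∈ D(Q)`, as `Q` takes the value `∞` off its domain). -/
def ClosedForm.IsDirichlet (Q : ClosedForm m) : Prop :=
  ∀ C : ℝ → ℝ, IsNormalContraction C → ∀ f : Q.domain, ∃ g : Q.domain,
    (∀ x, ((g : ell2 m) : X → ℝ) x = C (((f : ell2 m) : X → ℝ) x)) ∧ Q.bilin g g ≤ Q.bilin f f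

/-- The graph of the generator: the pairs `(f, w)` with `f ∈ D(Q)` and `Q(f, g) = ⟨w, g⟩` for all
`g ∈ D(Q)`. -/
def ClosedForm.generatorGraph (Q : ClosedForm m) : Submodule ℝ (ell2 m × ell2 m) where
  carrier := {p | ∃ hf : p.1 ∈ Q.domain, ∀ g : Q.domain, Q.bilin ⟨p.1, hf⟩ g = ell2Inner m p.2 g}
  zero_mem' := by
    refine ⟨Q.domain.zero_mem, fun g => ?_⟩
    have h0 : (⟨(0 : ell2 m × ell2 m).1, Q.domain.zero_mem⟩ : Q.domain) = 0 := rfl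
    rw [h0]
    simp [ell2Inner]
  add_mem' := by
    rintro p q ⟨hp, hp'⟩ ⟨hq, hq'⟩
    refine ⟨Q.domain.add_mem hp hq, fun g => ?_⟩
    have h0 : (⟨(p + q).1, Q.domain.add_mem hp hq⟩ : Q.domain) = ⟨p.1, hp⟩ + ⟨q.1, hq⟩ := rfl
    rw [h0, map_add, LinearMap.add_apply, hp', hq']
    unfold ell2Inner
    rw [← (ell2_summable_mul m p.2 g).tsum_add (ell2_summable_mul m q.2 g)]
    refine tsum_congr fun x => ?_
    simp only [Prod.snd_add, Submodule.coe_add, Pi.add_apply]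
    ring
  smul_mem' := by
    rintro a p ⟨hp, hp'⟩
    refine ⟨Q.domain.smul_mem a hp, fun g => ?_⟩
    have h0 : (⟨(a • p).1, Q.domain.smul_mem a hp⟩ : Q.domain) = a • ⟨p.1, hp⟩ := rfl
    rw [h0, map_smul, LinearMap.smul_apply, hp', smul_eq_mul]
    unfold ell2Inner
    rw [← tsum_mul_left]
    refine tsum_congr fun x => ?_
    simp only [Prod.smul_snd, Submodule.coe_smul, Pi.smul_apply, smul_eq_mul]
    ring

/-- The generator `L` of a form: the self-adjoint operator with domain
`{f ∈ D(Q) | ∃ w, ∀ g ∈ D(Q), Q(f, g) = ⟨w, g⟩}` and `L f = w`. -/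
noncomputable def ClosedForm.generator (Q : ClosedForm m) : ell2 m →ₗ.[ℝ] ell2 m :=
  Q.generatorGraph.toLinearPMap

/-- For a form associated to a graph the vector `w` is unique, so that the generator is well
defined. -/
theorem ClosedForm.IsAssociated.generator_graph {Q : ClosedForm m} {G : WGraph X}
    (hQ : Q.IsAssociated G) : Q.generator.graph = Q.generatorGraph := by
  refine Submodule.toLinearPMap_graph_eq _ ?_
  rintro ⟨f, w⟩ ⟨hf, hw⟩ (rfl : f = 0)
  ext x
  have hx : delta m x ∈ Q.domain := hQ.finite_support_mem _
    ((Set.finite_singleton x).subset Set.support_indicator_subset)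
  have h := hw ⟨delta m x, hx⟩
  have h0 : (⟨((0 : ell2 m), w).1, hf⟩ : Q.domain) = 0 := rfl
  rw [h0, map_zero, LinearMap.zero_apply] at h
  have h1 : ell2Inner m w (delta m x) = (w : X → ℝ) x * m x := by
    unfold ell2Inner
    rw [tsum_eq_single x]
    · rw [delta_self, mul_one]
    · intro y hy
      rw [delta_ne m hy]; simp
  change (0 : ℝ) = ell2Inner m w (delta m x) at h
  rw [h1] at h
  rcases mul_eq_zero.mp h.symm with h | h
  · simpa using h
  · exact absurd h (m.pos x).ne'

end Forms

/-- An order isomorphism `U : ℓ²(X₁, m₁) → ℓ²(X₂, m₂)`: a linear bijection such that `U` and its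
inverse are order preserving. -/
structure Ell2OrderIso {X₁ X₂ : Type*} (m₁ : FullMeasure X₁) (m₂ : FullMeasure X₂) where
  toEquiv : ell2 m₁ ≃ₗ[ℝ] ell2 m₂
  map_nonneg : ∀ f : ell2 m₁, (∀ x, 0 ≤ (f : X₁ → ℝ) x) → ∀ y, 0 ≤ (toEquiv f : X₂ → ℝ) y
  symm_nonneg : ∀ g : ell2 m₂, (∀ y, 0 ≤ (g : X₂ → ℝ) y) →
    ∀ x, 0 ≤ (toEquiv.symm g : X₁ → ℝ) x

section OrderIsos

variable {X₁ X₂ : Type*} {m₁ : FullMeasure X₁} {m₂ : FullMeasure X₂}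

instance : CoeFun (Ell2OrderIso m₁ m₂) (fun _ => ell2 m₁ → ell2 m₂) := ⟨fun U => U.toEquiv⟩

/-- `Uf = h · (f ∘ τ)` for all `f`, with `τ : X₂ → X₁` bijective and `h : X₂ → (0, ∞)`. -/
def Ell2OrderIso.IsRepresentedBy (U : Ell2OrderIso m₁ m₂) (τ : X₂ ≃ X₁) (h : X₂ → ℝ) : Prop :=
  (∀ y, 0 < h y) ∧ ∀ (f : ell2 m₁) (y : X₂), (U f : X₂ → ℝ) y = h y * (f : X₁ → ℝ) (τ y)

theorem Ell2OrderIso.map_mono (U : Ell2OrderIso m₁ m₂) {f g : ell2 m₁}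
    (hfg : ∀ x, (f : X₁ → ℝ) x ≤ (g : X₁ → ℝ) x) (y : X₂) :
    (U f : X₂ → ℝ) y ≤ (U g : X₂ → ℝ) y := by
  have h := U.map_nonneg (g - f) (fun x => by simpa using hfg x) y
  rw [map_sub] at h
  simpa using h

theorem Ell2OrderIso.symm_mono (U : Ell2OrderIso m₁ m₂) {f g : ell2 m₂}
    (hfg : ∀ x, (f : X₂ → ℝ) x ≤ (g : X₂ → ℝ) x) (y : X₁) :
    (U.toEquiv.symm f : X₁ → ℝ) y ≤ (U.toEquiv.symm g : X₁ → ℝ) y := by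
  have h := U.symm_nonneg (g - f) (fun x => by simpa using hfg x) y
  rw [map_sub] at h
  simpa using h

theorem Ell2OrderIso.disjoint (U : Ell2OrderIso m₁ m₂) {f g : ell2 m₁}
    (hf : ∀ x, 0 ≤ (f : X₁ → ℝ) x) (hg : ∀ x, 0 ≤ (g : X₁ → ℝ) x)
    (hfg : ∀ x, (f : X₁ → ℝ) x = 0 ∨ (g : X₁ → ℝ) x = 0) (y : X₂)
    (hgy : (U g : X₂ → ℝ) y ≠ 0) : (U f : X₂ → ℝ) y = 0 := by
  by_contra hfy
  have hf' := lt_of_le_of_ne (U.map_nonneg f hf y) (Ne.symm hfy)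
  have hg' := lt_of_le_of_ne (U.map_nonneg g hg y) (Ne.symm hgy)
  set t := min ((U f : X₂ → ℝ) y) ((U g : X₂ → ℝ) y) with ht
  have htpos : 0 < t := lt_min hf' hg'
  have hk0 : ∀ z, 0 ≤ ((t • delta m₂ y : ell2 m₂) : X₂ → ℝ) z := by
    intro z
    by_cases hz : z = y
    · subst hz
      simp only [Submodule.coe_smul, Pi.smul_apply, delta_self, smul_eq_mul, mul_one]
      exact htpos.le
    · simp [delta_ne m₂ hz]
  have hle : ∀ (e : ell2 m₁), (∀ x, 0 ≤ (e : X₁ → ℝ) x) → t ≤ (U e : X₂ → ℝ) y →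
      ∀ z, ((t • delta m₂ y : ell2 m₂) : X₂ → ℝ) z ≤ (U e : X₂ → ℝ) z := by
    intro e he hte z
    by_cases hz : z = y
    · subst hz
      simpa only [Submodule.coe_smul, Pi.smul_apply, delta_self, smul_eq_mul, mul_one] using hte
    · simpa [delta_ne m₂ hz] using U.map_nonneg e he z
  have h1 := U.symm_mono (hle f hf (min_le_left _ _))
  have h2 := U.symm_mono (hle g hg (min_le_right _ _))
  have h3 := U.symm_nonneg _ hk0
  have hz : U.toEquiv.symm (t • delta m₂ y) = 0 := by
    ext x
    rcases hfg x with h | h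
    · exact le_antisymm (by simpa [h] using h1 x) (h3 x)
    · exact le_antisymm (by simpa [h] using h2 x) (h3 x)
  have hz' : t • delta m₂ y = 0 := by simpa using hz
  have hz2 := congrArg (fun e : ell2 m₂ => (e : X₂ → ℝ) y) hz'
  simp only [Submodule.coe_smul, Pi.smul_apply, delta_self, smul_eq_mul, mul_one,
    Submodule.coe_zero, Pi.zero_apply] at hz2
  exact htpos.ne' hz2

theorem delta_nonneg {X : Type*} (m : FullMeasure X) (x z : X) : 0 ≤ (delta m x : X → ℝ) z := by
  by_cases hz : z = x
  · subst hz; rw [delta_self]; exact zero_le_one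
  · rw [delta_ne m hz]

theorem Ell2OrderIso.exists_representation (U : Ell2OrderIso m₁ m₂) :
    ∃ (τ : X₂ ≃ X₁) (h : X₂ → ℝ), U.IsRepresentedBy τ h := by
  have key : ∀ y : X₂, ∃ (x : X₁) (t : ℝ), 0 < t ∧
      ∀ f : ell2 m₁, (U f : X₂ → ℝ) y = t * (f : X₁ → ℝ) x := by
    intro y
    set e := U.toEquiv.symm (delta m₂ y) with he
    have he0 : ∀ x, 0 ≤ (e : X₁ → ℝ) x := U.symm_nonneg _ (delta_nonneg m₂ y)
    have hUe : U e = delta m₂ y := by simp [he]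
    obtain ⟨x, hx⟩ : ∃ x, (e : X₁ → ℝ) x ≠ 0 := by
      by_contra! hall
      have : e = 0 := by ext x; exact hall x
      rw [this, map_zero] at hUe
      have := congrArg (fun e : ell2 m₂ => (e : X₂ → ℝ) y) hUe
      simp [delta_self] at this
    have hUd0 : ∀ z, 0 ≤ (U (delta m₁ x) : X₂ → ℝ) z := U.map_nonneg _ (delta_nonneg m₁ x)
    have hle : ∀ z, (((e : X₁ → ℝ) x • delta m₁ x : ell2 m₁) : X₁ → ℝ) z ≤ (e : X₁ → ℝ) z := by
      intro z
      by_cases hz : z = x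
      · subst hz; simp [delta_self]
      · simpa [delta_ne m₁ hz] using he0 z
    have hUle := U.map_mono hle
    have hpos : (U (delta m₁ x) : X₂ → ℝ) y ≠ 0 := by
      intro h0
      have hzero : U (delta m₁ x) = 0 := by
        ext z
        by_cases hz : z = y
        · subst hz; simpa using h0
        · have h1 := hUle z
          rw [hUe, delta_ne m₂ hz, map_smul] at h1
          simp only [Submodule.coe_smul, Pi.smul_apply, smul_eq_mul] at h1
          have hxp := lt_of_le_of_ne (he0 x) (Ne.symm hx)
          have h2 := hUd0 z
          have h3 : (U (delta m₁ x) : X₂ → ℝ) z ≤ 0 := by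
            by_contra! hc
            exact absurd h1 (not_le.mpr (mul_pos hxp hc))
          exact le_antisymm h3 h2
      have hd : delta m₁ x = 0 := by simpa using hzero
      have := congrArg (fun e : ell2 m₁ => (e : X₁ → ℝ) x) hd
      simp [delta_self] at this
    refine ⟨x, (U (delta m₁ x) : X₂ → ℝ) y, lt_of_le_of_ne (hUd0 y) (Ne.symm hpos), fun f => ?_⟩
    set r := f - (f : X₁ → ℝ) x • delta m₁ x with hr
    have hrx : (r : X₁ → ℝ) x = 0 := by simp [hr, delta_self]
    have habs : (fun z => |(r : X₁ → ℝ) z|) ∈ ell2 m₁ := by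
      have := r.2
      change Summable _ at this
      change Summable _
      simpa only [sq_abs] using this
    set a : ell2 m₁ := ⟨_, habs⟩ with ha
    have ha0 : ∀ z, 0 ≤ (a : X₁ → ℝ) z := fun z => abs_nonneg _
    have hUa : (U a : X₂ → ℝ) y = 0 := by
      refine U.disjoint ha0 (delta_nonneg m₁ x) (fun z => ?_) y hpos
      by_cases hz : z = x
      · left; subst hz; change |(r : X₁ → ℝ) z| = 0; rw [hrx, abs_zero]
      · right; exact delta_ne m₁ hz
    have hr1 := U.map_mono (f := r) (g := a) (fun z => le_abs_self _) y
    have hr2 := U.map_mono (f := -a) (g := r) (fun z => neg_abs_le _) y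
    rw [map_neg] at hr2
    simp only [Submodule.coe_neg, Pi.neg_apply, hUa, neg_zero] at hr2
    rw [hUa] at hr1
    have hr3 : (U r : X₂ → ℝ) y = 0 := le_antisymm hr1 hr2
    rw [hr, map_sub, map_smul] at hr3
    simp only [Submodule.coe_sub, Submodule.coe_smul, Pi.sub_apply, Pi.smul_apply,
      smul_eq_mul] at hr3
    linarith
  choose τ h hpos hU using key
  have hbij : Function.Bijective τ := by
    constructor
    · intro y y' hyy
      by_contra hne
      have h1 := hU y (U.toEquiv.symm (delta m₂ y))
      have h2 := hU y' (U.toEquiv.symm (delta m₂ y))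
      rw [← hyy] at h2
      simp only [LinearEquiv.apply_symm_apply] at h1 h2
      rw [delta_self] at h1
      rw [delta_ne m₂ (Ne.symm hne)] at h2
      rcases mul_eq_zero.mp h2.symm with h3 | h3
      · exact (hpos y').ne' h3
      · rw [h3, mul_zero] at h1
        exact one_ne_zero h1
    · intro x
      by_contra! hx
      have hzero : U (delta m₁ x) = 0 := by
        ext z
        rw [hU z, delta_ne m₁ (hx z)]
        simp
      have hd : delta m₁ x = 0 := by simpa using hzero
      have := congrArg (fun e : ell2 m₁ => (e : X₁ → ℝ) x) hd
      simp [delta_self] at this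
  exact ⟨Equiv.ofBijective τ hbij, h, hpos, fun f y => hU y f⟩

/-- The bijection `τ : X₂ → X₁` associated to `U`. -/
noncomputable def Ell2OrderIso.bijection (U : Ell2OrderIso m₁ m₂) : X₂ ≃ X₁ :=
  U.exists_representation.choose

/-- The scaling `h : X₂ → (0, ∞)` associated to `U`. -/
noncomputable def Ell2OrderIso.scaling (U : Ell2OrderIso m₁ m₂) : X₂ → ℝ :=
  U.exists_representation.choose_spec.choose

theorem Ell2OrderIso.isRepresentedBy (U : Ell2OrderIso m₁ m₂) :
    U.IsRepresentedBy U.bijection U.scaling :=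
  U.exists_representation.choose_spec.choose_spec

/-- The bijection and the scaling are the only pair that represents `U`. -/
theorem Ell2OrderIso.IsRepresentedBy.unique {U : Ell2OrderIso m₁ m₂} {τ : X₂ ≃ X₁} {h : X₂ → ℝ}
    (H : U.IsRepresentedBy τ h) : τ = U.bijection ∧ h = U.scaling := by
  have K := U.isRepresentedBy
  have hτ : ∀ y, τ y = U.bijection y := by
    intro y
    by_contra hne
    have h1 := H.2 (delta m₁ (τ y)) y
    rw [K.2, delta_ne m₁ (Ne.symm hne), delta_self, mul_zero, mul_one] at h1
    exact (H.1 y).ne h1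
  refine ⟨Equiv.ext hτ, funext fun y => ?_⟩
  have h1 := H.2 (delta m₁ (τ y)) y
  rw [K.2, ← hτ, delta_self, mul_one, mul_one] at h1
  exact h1.symm

/-- `U` intertwines the (unbounded) operators `L₁` and `L₂`: `U D(L₁) = D(L₂)` and
`U L₁ f = L₂ U f` for all `f ∈ D(L₁)`. -/
def Ell2OrderIso.Intertwines (U : Ell2OrderIso m₁ m₂) (L₁ : ell2 m₁ →ₗ.[ℝ] ell2 m₁)
    (L₂ : ell2 m₂ →ₗ.[ℝ] ell2 m₂) : Prop :=
  U '' (L₁.domain : Set (ell2 m₁)) = (L₂.domain : Set (ell2 m₂)) ∧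
    ∀ (f : L₁.domain) (g : L₂.domain), (g : ell2 m₂) = U f → U (L₁ f) = L₂ g

end OrderIsos

end GraphDiffusion

open GraphDiffusion

namespace GraphDiffusion

/-! The unbounded generators are traded for the everywhere defined resolvents `R = (L + 1)⁻¹`, which
`U` also intertwines (`map_resolvent`). With r(x, y) = (R 1_x)(y), this reads h(a) r₂(a, b) = h(b)
r₁(τa, τb). Each kernel is symmetric up to the weights, r(x, y) m(y) = r(y, x) m(x). Wherever r₁
does not vanish, m₁(τw) / (h(w)² m₂(w)) therefore agrees at the two vertices. The Dirichlet property
and connectedness make r₁ strictly positive (`resolvent_delta_pos`), so this quotient is a constant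
β and √β U is unitary.

A form, domain included, is recovered from its resolvent by a family of inequalities
(`ClosedForm.IsAssociated.formInner_le_iff`). These transfer along `U`, and polarization gives the
identity of the forms. Testing it on characteristic functions, where Green's formula turns the form
into the formal Laplacian, yields b off the diagonal and c on it. -/

/-- Riesz representation for a complete positive definite bilinear form: a functional defined on a
subspace and bounded for the form is represented by a vector of the same bound. -/
theorem exists_representing_vector {V : Type*} [AddCommGroup V] [Module ℝ V]
    (B : LinearMap.BilinForm ℝ V) (symm : ∀ u v, B u v = B v u) (nonneg : ∀ u, 0 ≤ B u u)
    (definite : ∀ u, B u u = 0 → u = 0)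
    (complete : ∀ u : ℕ → V,
      (∀ ε > 0, ∃ N, ∀ i ≥ N, ∀ j ≥ N, B (u i - u j) (u i - u j) < ε) →
      ∃ v, Filter.Tendsto (fun n => B (u n - v) (u n - v)) Filter.atTop (𝓝 0))
    (p : Submodule ℝ V) (φ : p →ₗ[ℝ] ℝ) {C : ℝ} (hC : 0 ≤ C)
    (hφ : ∀ u : p, φ u ^ 2 ≤ C * B u u) :
    ∃ w : V, B w w ≤ C ∧ ∀ u : p, B w u = φ u := by
  let core : InnerProductSpace.Core ℝ V :=
    { inner := fun u v => B u v
      conj_inner_symm := fun u v => symm v u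
      re_inner_nonneg := nonneg
      add_left := fun u v w => by simp
      smul_left := fun u v r => by simp
      definite := definite }
  let _ : NormedAddCommGroup V := core.toNormedAddCommGroup
  let _ : InnerProductSpace ℝ V := InnerProductSpace.ofCore core.toCore
  have inner_eq : ∀ u v : V, inner ℝ u v = B u v := fun _ _ => rfl
  have norm_sq : ∀ u : V, ‖u‖ ^ 2 = B u u := fun u => by
    rw [← inner_eq, real_inner_self_eq_norm_sq]
  have : CompleteSpace V := by
    refine Metric.complete_of_cauchySeq_tendsto fun u hu => ?_
    obtain ⟨v, hv⟩ := complete u fun ε hε => by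
      obtain ⟨N, hN⟩ := Metric.cauchySeq_iff.1 hu (√ε) (Real.sqrt_pos.2 hε)
      refine ⟨N, fun i hi j hj => ?_⟩
      rw [← norm_sq, ← dist_eq_norm, ← Real.lt_sqrt dist_nonneg]
      exact hN i hi j hj
    refine ⟨v, ?_⟩
    rw [tendsto_iff_norm_sub_tendsto_zero]
    have h := hv.sqrt
    rw [Real.sqrt_zero] at h
    refine h.congr fun n => ?_
    rw [← norm_sq, Real.sqrt_sq (norm_nonneg _)]
  have bound : ∀ u : p, ‖φ u‖ ≤ √C * ‖u‖ := fun u => by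
    have h := hφ u
    rw [← norm_sq] at h
    refine abs_le_of_sq_le_sq ?_ (by positivity)
    rw [mul_pow, Real.sq_sqrt hC]
    exact h
  let ψ : StrongDual ℝ p := φ.mkContinuous (√C) bound
  -- The subspace need not be closed; a norm-preserving Hahn–Banach extension keeps the bound √C,
  -- hence `B w w ≤ C`.
  obtain ⟨g, hg, hgn⟩ := exists_extension_norm_eq p ψ
  refine ⟨(InnerProductSpace.toDual ℝ V).symm g, ?_, fun u => ?_⟩
  · rw [← norm_sq, LinearIsometryEquiv.norm_map, hgn, ← Real.sq_sqrt hC]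
    gcongr
    exact φ.mkContinuous_norm_le (Real.sqrt_nonneg _) _
  · rw [← inner_eq, InnerProductSpace.toDual_symm_apply]
    exact hg u

/-! ### The resolvent of a closed form -/

section Resolvent

variable {X : Type*} {m : FullMeasure X}

/-- The scalar product of `ℓ²(X, m)` as a bilinear form. -/
noncomputable def ell2Form (m : FullMeasure X) : LinearMap.BilinForm ℝ (ell2 m) :=
  LinearMap.mk₂ ℝ (ell2Inner m)
    (fun u v w => by
      unfold ell2Inner
      rw [← (ell2_summable_mul m u w).tsum_add (ell2_summable_mul m v w)]
      exact tsum_congr fun x => by simp only [Submodule.coe_add, Pi.add_apply]; ring)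
    (fun a u w => by
      unfold ell2Inner
      rw [smul_eq_mul, ← tsum_mul_left]
      exact tsum_congr fun x => by
        simp only [Submodule.coe_smul, Pi.smul_apply, smul_eq_mul]; ring)
    (fun u v w => by
      unfold ell2Inner
      rw [← (ell2_summable_mul m u v).tsum_add (ell2_summable_mul m u w)]
      exact tsum_congr fun x => by simp only [Submodule.coe_add, Pi.add_apply]; ring)
    (fun a u w => by
      unfold ell2Inner
      rw [smul_eq_mul, ← tsum_mul_left]
      exact tsum_congr fun x => by
        simp only [Submodule.coe_smul, Pi.smul_apply, smul_eq_mul]; ring)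

theorem ell2Form_apply (u v : ell2 m) : ell2Form m u v = ell2Inner m u v := rfl

theorem ell2Form_comm (u v : ell2 m) : ell2Form m u v = ell2Form m v u :=
  tsum_congr fun x => by ring

theorem ell2Form_self_nonneg (u : ell2 m) : 0 ≤ ell2Form m u u :=
  tsum_nonneg fun x => mul_nonneg (mul_self_nonneg _) (m.pos x).le

theorem ell2Form_self_eq_zero {u : ell2 m} (hu : ell2Form m u u = 0) : u = 0 := by
  have hsum : HasSum _ (ell2Form m u u) := (ell2_summable_mul m u u).hasSum
  rw [hu] at hsum
  have h := (hasSum_zero_iff_of_nonneg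
    fun x => mul_nonneg (mul_self_nonneg ((u : X → ℝ) x)) (m.pos x).le).1 hsum
  ext x
  have hx := congrFun h x
  simpa [(m.pos x).ne'] using hx

theorem ell2Form_delta (u : ell2 m) (x : X) :
    ell2Form m u (delta m x) = (u : X → ℝ) x * m x := by
  rw [ell2Form_apply, ell2Inner, tsum_eq_single x fun y hy => by rw [delta_ne m hy]; simp,
    delta_self, mul_one]

/-- The form `Q(u, v) + ⟨u, v⟩` on `D(Q)`. -/
noncomputable def ClosedForm.formInner (Q : ClosedForm m) : LinearMap.BilinForm ℝ Q.domain :=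
  Q.bilin + (ell2Form m).compl₁₂ Q.domain.subtype Q.domain.subtype

theorem ClosedForm.formInner_apply (Q : ClosedForm m) (u v : Q.domain) :
    Q.formInner u v = Q.bilin u v + ell2Form m u v := rfl

theorem ClosedForm.formInner_comm (Q : ClosedForm m) (u v : Q.domain) :
    Q.formInner u v = Q.formInner v u := by
  rw [formInner_apply, formInner_apply, Q.symm, ell2Form_comm]

theorem ClosedForm.ell2Form_le_formInner (Q : ClosedForm m) (u : Q.domain) :
    ell2Form m u u ≤ Q.formInner u u := by
  rw [formInner_apply]
  exact le_add_of_nonneg_left (Q.nonneg u)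

theorem ClosedForm.formInner_self_nonneg (Q : ClosedForm m) (u : Q.domain) :
    0 ≤ Q.formInner u u :=
  (ell2Form_self_nonneg _).trans (Q.ell2Form_le_formInner u)

theorem ClosedForm.eq_zero_of_formInner_self (Q : ClosedForm m) {u : Q.domain}
    (hu : Q.formInner u u ≤ 0) : u = 0 :=
  Subtype.ext <| ell2Form_self_eq_zero <|
    ((Q.ell2Form_le_formInner u).trans hu).antisymm (ell2Form_self_nonneg _)

theorem ClosedForm.eq_of_formInner_eq (Q : ClosedForm m) {u u' : Q.domain}
    (h : ∀ v, Q.formInner u v = Q.formInner u' v) : u = u' :=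
  sub_eq_zero.1 <| Q.eq_zero_of_formInner_self <|
    ((Q.formInner.map_sub₂ u u' (u - u')).trans (by rw [h, sub_self])).le

/-- Closedness of `Q` is exactly completeness for `formInner`, so Riesz representation applies on
the form domain. -/
theorem ClosedForm.exists_formInner_eq (Q : ClosedForm m) (p : Submodule ℝ Q.domain)
    (φ : p →ₗ[ℝ] ℝ) {C : ℝ} (hC : 0 ≤ C) (hφ : ∀ u : p, φ u ^ 2 ≤ C * Q.formInner u u) :
    ∃ w : Q.domain, Q.formInner w w ≤ C ∧ ∀ u : p, Q.formInner w u = φ u :=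
  exists_representing_vector (V := Q.domain) Q.formInner Q.formInner_comm Q.formInner_self_nonneg
    (fun _ hu => Q.eq_zero_of_formInner_self hu.le) Q.closed p φ hC hφ

/-- The functional ⟨f, ·⟩ is bounded for the form norm, which dominates the ℓ² norm. Linearity comes
from uniqueness of the representing vector. -/
theorem ClosedForm.exists_resolvent (Q : ClosedForm m) :
    ∃ R : ell2 m →ₗ[ℝ] Q.domain, ∀ f v, Q.formInner (R f) v = ell2Form m f v := by
  have key : ∀ f : ell2 m, ∃ u : Q.domain, ∀ v, Q.formInner u v = ell2Form m f v := by
    intro f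
    obtain ⟨w, -, hw⟩ := Q.exists_formInner_eq ⊤
      (ell2Form m f ∘ₗ Q.domain.subtype ∘ₗ (⊤ : Submodule ℝ Q.domain).subtype)
      (ell2Form_self_nonneg f) fun u => by
        refine ((ell2Form m).apply_sq_le_of_symm ell2Form_self_nonneg ⟨ell2Form_comm⟩ f u).trans ?_
        exact mul_le_mul_of_nonneg_left (Q.ell2Form_le_formInner u) (ell2Form_self_nonneg f)
    exact ⟨w, fun v => hw ⟨v, trivial⟩⟩
  choose R hR using key
  exact ⟨{  toFun := R
            map_add' := fun f g => Q.eq_of_formInner_eq fun v => by simp [hR]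
            map_smul' := fun a f => Q.eq_of_formInner_eq fun v => by simp [hR] }, hR⟩

/-- The resolvent `(L + 1)⁻¹` of the generator of `Q`, with values in the form domain. -/
noncomputable def ClosedForm.resolvent (Q : ClosedForm m) : ell2 m →ₗ[ℝ] Q.domain :=
  Q.exists_resolvent.choose

theorem ClosedForm.formInner_resolvent (Q : ClosedForm m) (f : ell2 m) (v : Q.domain) :
    Q.formInner (Q.resolvent f) v = ell2Form m f v :=
  Q.exists_resolvent.choose_spec f v

theorem ClosedForm.eq_resolvent (Q : ClosedForm m) {f : ell2 m} {u : Q.domain}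
    (h : ∀ v, Q.formInner u v = ell2Form m f v) : u = Q.resolvent f :=
  Q.eq_of_formInner_eq fun v => by rw [h, Q.formInner_resolvent]

theorem ClosedForm.ell2Form_resolvent_comm (Q : ClosedForm m) (f g : ell2 m) :
    ell2Form m f (Q.resolvent g) = ell2Form m g (Q.resolvent f) := by
  rw [← Q.formInner_resolvent, ← Q.formInner_resolvent, Q.formInner_comm]

/-- Adding ⟨f, ·⟩ to both sides turns `L f = w` into `(L + 1) f = f + w`, an equation free of domain
questions. -/
theorem ClosedForm.mem_generatorGraph_iff (Q : ClosedForm m) (f w : ell2 m) :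
    (f, w) ∈ Q.generatorGraph ↔ f = Q.resolvent (f + w) := by
  constructor
  · rintro ⟨hf, h⟩
    refine congrArg Subtype.val (Q.eq_resolvent (u := ⟨f, hf⟩) fun v => ?_)
    rw [Q.formInner_apply, h v, map_add, LinearMap.add_apply, add_comm]
    rfl
  · intro h
    have hf : f ∈ Q.domain := h ▸ (Q.resolvent (f + w)).2
    refine ⟨hf, fun v => ?_⟩
    have h1 : (⟨f, hf⟩ : Q.domain) = Q.resolvent (f + w) := Subtype.ext h
    have h2 := Q.formInner_resolvent (f + w) v
    rw [← h1, Q.formInner_apply, map_add, LinearMap.add_apply, add_comm] at h2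
    exact add_left_cancel h2

variable {G : WGraph X} {Q : ClosedForm m}

theorem ClosedForm.IsAssociated.delta_mem (hQ : Q.IsAssociated G) (x : X) :
    delta m x ∈ Q.domain :=
  hQ.finite_support_mem _ ((Set.finite_singleton x).subset Set.support_indicator_subset)

theorem ClosedForm.IsAssociated.resolvent_injective (hQ : Q.IsAssociated G) :
    Function.Injective Q.resolvent := by
  refine (injective_iff_map_eq_zero _).2 fun f hf => ?_
  ext x
  have h := Q.formInner_resolvent f ⟨delta m x, hQ.delta_mem x⟩
  rw [hf, map_zero, LinearMap.zero_apply, ell2Form_delta, eq_comm] at h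
  simpa [(m.pos x).ne'] using h

/-- The form is determined by its resolvent. -/
theorem ClosedForm.IsAssociated.formInner_le_iff (hQ : Q.IsAssociated G) (v : ell2 m) {C : ℝ}
    (hC : 0 ≤ C) :
    (∃ hv : v ∈ Q.domain, Q.formInner ⟨v, hv⟩ ⟨v, hv⟩ ≤ C) ↔
      ∀ f, ell2Form m f v ^ 2 ≤ C * ell2Form m f (Q.resolvent f) := by
  constructor
  · rintro ⟨hv, h⟩ f
    rw [← Q.formInner_resolvent f (Q.resolvent f), ← Q.formInner_resolvent f ⟨v, hv⟩, mul_comm]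
    refine (Q.formInner.apply_sq_le_of_symm Q.formInner_self_nonneg ⟨fun x y => Q.formInner_comm x y⟩ _ _).trans ?_
    exact mul_le_mul_of_nonneg_left h (Q.formInner_self_nonneg _)
  · intro h
    -- By injectivity, `R f ↦ ⟨f, v⟩` is a well-defined functional on the range of the resolvent,
    -- and the hypothesis bounds it by `C`. Its representing vector lies in `D(Q)`; testing against
    -- `R 1_x` shows that it is `v`.
    let e := LinearEquiv.ofInjective Q.resolvent hQ.resolvent_injective
    obtain ⟨w, hw, hwv⟩ := Q.exists_formInner_eq (LinearMap.range Q.resolvent)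
      ((ell2Form m).flip v ∘ₗ e.symm.toLinearMap) hC fun u => by
        obtain ⟨f, rfl⟩ := e.surjective u
        have h1 : ((e f : LinearMap.range Q.resolvent) : Q.domain) = Q.resolvent f := rfl
        rw [h1, Q.formInner_resolvent]
        simpa using h f
    have hwv' : (w : ell2 m) = v := by
      ext x
      have h1 := hwv (e (delta m x))
      have h2 : ((e (delta m x) : LinearMap.range Q.resolvent) : Q.domain)
        = Q.resolvent (delta m x) := rfl
      rw [h2, Q.formInner_comm, Q.formInner_resolvent] at h1
      simp only [LinearMap.coe_comp, LinearEquiv.coe_coe, Function.comp_apply,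
        LinearEquiv.symm_apply_apply] at h1
      change ell2Form m (delta m x) w = ell2Form m (delta m x) v at h1
      rw [ell2Form_comm, ell2Form_delta, ell2Form_comm, ell2Form_delta] at h1
      exact mul_right_cancel₀ (m.pos x).ne' h1
    subst hwv'
    exact ⟨w.2, hw⟩

end Resolvent

/-! ### Green's formula and positivity of the resolvent kernel -/

section GraphForms

variable {X : Type*} {m : FullMeasure X} {G : WGraph X} {Q : ClosedForm m}

/-- Since |t| ≤ 1 + t², the row is dominated by its weights plus its share of the energy. -/
theorem WGraph.summable_mul_sub {u : X → ℝ} (hu : G.energy u < ∞) (x : X) :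
    Summable fun z => G.b x z * (u x - u z) := by
  have h1 : ∑' p : X × X, ENNReal.ofReal (G.b p.1 p.2 * |u p.1 - u p.2| ^ 2) ≠ ∞ := by
    intro h
    rw [WGraph.energy, h, ENNReal.mul_top (by simp), top_add] at hu
    exact lt_irrefl _ hu
  have h2 := (ENNReal.summable_toReal h1).comp_injective (Prod.mk_right_injective x)
  have h3 : Summable fun z => G.b x z * |u x - u z| ^ 2 := by
    refine h2.congr fun z => ?_
    exact ENNReal.toReal_ofReal (mul_nonneg (G.b_nonneg _ _) (sq_nonneg _))
  refine Summable.of_norm_bounded ((G.b_summable x).add h3) fun z => ?_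
  rw [Real.norm_eq_abs, abs_mul, abs_of_nonneg (G.b_nonneg x z)]
  nlinarith [G.b_nonneg x z, sq_nonneg (|u x - u z| - 1), abs_nonneg (u x - u z),
    mul_nonneg (G.b_nonneg x z) (sq_nonneg (|u x - u z| - 1)),
    mul_nonneg (G.b_nonneg x z) (abs_nonneg (u x - u z))]

/-- Green's formula for characteristic functions of vertices. -/
theorem WGraph.energyBilin_delta {u : X → ℝ} (hu : G.energy u < ∞) (x : X) :
    G.energyBilin u (delta m x : X → ℝ) = G.formalLaplacian u x := by
  classical
  -- The energy sum against `1_x` lives on row x and column x. `A` is the row part and its swap the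
  -- column part; their equal sums absorb the factor 1/2.
  let A : X × X → ℝ := fun p => if p.1 = x then G.b x p.2 * (u x - u p.2) else 0
  have hA : HasSum A (∑' z, G.b x z * (u x - u z)) := by
    rw [← (Prod.mk_right_injective x).hasSum_iff]
    · have : A ∘ Prod.mk x = fun z => G.b x z * (u x - u z) := by ext z; simp [A]
      rw [this]
      exact (summable_mul_sub hu x).hasSum
    · rintro ⟨a, z⟩ hp
      refine if_neg fun h => hp ⟨z, ?_⟩
      rw [← h]
  have hA' : HasSum (A ∘ Prod.swap) (∑' z, G.b x z * (u x - u z)) :=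
    (Equiv.prodComm X X).hasSum_iff.2 hA
  have hF : (fun p : X × X => G.b p.1 p.2 * ((u p.1 - u p.2) *
      ((delta m x : X → ℝ) p.1 - (delta m x : X → ℝ) p.2))) = fun p => A p + (A ∘ Prod.swap) p := by
    ext ⟨y, z⟩
    by_cases hy : y = x <;> by_cases hz : z = x
    · simp [A, hy, hz]
    · subst hy
      simp [A, hz, delta_self, delta_ne m hz]
    · subst hz
      simp only [delta_ne m hy, delta_self, A, if_neg hy, Function.comp_apply, Prod.swap_prod_mk,
        if_true, G.b_symm z y]
      ring
    · simp [A, hy, hz, delta_ne m hy, delta_ne m hz]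
  rw [energyBilin, hF, (hA.add hA').tsum_eq, tsum_eq_single (f := fun y => G.c y * (u y * (delta m x : X → ℝ) y)) x, delta_self,
    formalLaplacian]
  · ring
  · intro y hy
    simp [delta_ne m hy]

theorem ClosedForm.resolvent_delta_comm (Q : ClosedForm m) (x y : X) :
    ((Q.resolvent (delta m x) : ell2 m) : X → ℝ) y * m y =
      ((Q.resolvent (delta m y) : ell2 m) : X → ℝ) x * m x := by
  rw [← ell2Form_delta, ← ell2Form_delta, ell2Form_comm, Q.ell2Form_resolvent_comm,
    ell2Form_comm]

theorem ClosedForm.IsAssociated.bilin_delta (hQ : Q.IsAssociated G) (u : Q.domain) (x : X) :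
    Q.bilin u ⟨delta m x, hQ.delta_mem x⟩ = G.formalLaplacian ((u : ell2 m) : X → ℝ) x := by
  rw [hQ.eq_energyBilin, WGraph.energyBilin_delta (hQ.energy_lt_top _ u.2)]

theorem WGraph.formalLaplacian_delta_of_ne {x y : X} (h : y ≠ x) :
    G.formalLaplacian (delta m x : X → ℝ) y = -G.b y x := by
  rw [formalLaplacian, tsum_eq_single x fun z hz => by simp [delta_ne m hz, delta_ne m h],
    delta_self, delta_ne m h]
  ring

theorem WGraph.formalLaplacian_delta_self (x : X) :
    G.formalLaplacian (delta m x : X → ℝ) x = ∑' y, G.b x y + G.c x := by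
  rw [formalLaplacian, delta_self, mul_one]
  congr 1
  refine tsum_congr fun y => ?_
  by_cases hy : y = x
  · subst hy; simp [G.b_diag]
  · simp [delta_ne m hy]

/-- The resolvent of a Dirichlet form preserves positivity. -/
theorem ClosedForm.IsDirichlet.resolvent_nonneg (hD : Q.IsDirichlet) {f : ell2 m}
    (hf : ∀ x, 0 ≤ (f : X → ℝ) x) (x : X) : 0 ≤ ((Q.resolvent f : ell2 m) : X → ℝ) x := by
  set u := Q.resolvent f with hu
  -- `R f` is the unique minimizer of `formInner v v - 2⟨f, v⟩`. Replacing `u` by `|u|` does not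
  -- increase this functional when `f ≥ 0`, so `u = |u|`.
  obtain ⟨a, ha, hQa⟩ := hD (fun t => |t|)
    ⟨fun p => (abs_abs p).le, fun p q => abs_abs_sub_abs_le p q⟩ u
  have h1 : ell2Form m a a = ell2Form m u u := tsum_congr fun z => by
    rw [ha, abs_mul_abs_self]
  have h2 : ell2Form m f u ≤ ell2Form m f a :=
    (ell2_summable_mul m f u).tsum_le_tsum (fun z => by
      rw [ha]
      exact mul_le_mul_of_nonneg_right (mul_le_mul_of_nonneg_left (le_abs_self _) (hf z))
        (m.pos z).le) (ell2_summable_mul m f a)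
  have h3 : Q.formInner a a ≤ Q.formInner u u := by
    rw [Q.formInner_apply, Q.formInner_apply, h1]
    gcongr
  have h4 : Q.formInner (a - u) (a - u)
      = Q.formInner a a - 2 * Q.formInner u a + Q.formInner u u := by
    refine (Q.formInner.map_sub₂ a u (a - u)).trans ?_
    have e₁ : Q.formInner a (a - u) = _ := (Q.formInner a).map_sub a u
    have e₂ : Q.formInner u (a - u) = _ := (Q.formInner u).map_sub a u
    rw [e₁, e₂, Q.formInner_comm a u]
    ring
  have h5 : a = u := by
    refine sub_eq_zero.1 (Q.eq_zero_of_formInner_self ?_)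
    have h6 := Q.formInner_resolvent f u
    have h7 := Q.formInner_resolvent f a
    rw [← hu] at h6 h7
    linarith
  rw [← h5, ha]
  exact abs_nonneg _

/-- On a connected graph the resolvent kernel of a Dirichlet form is strictly positive. -/
theorem ClosedForm.IsAssociated.resolvent_delta_pos (hQ : Q.IsAssociated G) (hD : Q.IsDirichlet)
    (hG : G.IsConnected) (x y : X) : 0 < ((Q.resolvent (delta m y) : ell2 m) : X → ℝ) x := by
  set u := Q.resolvent (delta m y) with hu
  have hu0 : ∀ z, 0 ≤ ((u : ell2 m) : X → ℝ) z := hD.resolvent_nonneg (delta_nonneg m y)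
  -- At a zero z of u, the equation ℒu + m u = m 1_y reduces to -∑ b(z, w) u(w) = 1_y(z) m(z). As u
  -- ≥ 0, both sides vanish: zeros spread to neighbours and cannot occur at y.
  have key : ∀ z, ((u : ell2 m) : X → ℝ) z = 0 →
      HasSum (fun w => G.b z w * ((u : ell2 m) : X → ℝ) w)
        (-((delta m y : X → ℝ) z * m z)) := by
    intro z hz
    have h1 := Q.formInner_resolvent (delta m y) ⟨delta m z, hQ.delta_mem z⟩
    rw [← hu, Q.formInner_apply, hQ.bilin_delta, ell2Form_delta, ell2Form_delta,
      WGraph.formalLaplacian, hz, zero_mul, mul_zero, add_zero, add_zero] at h1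
    have h2 := (WGraph.summable_mul_sub (hQ.energy_lt_top _ u.2) z).hasSum
    rw [hz, h1] at h2
    simpa using h2.neg
  have hzero : ∀ z, ((u : ell2 m) : X → ℝ) z = 0 → (delta m y : X → ℝ) z = 0 ∧
      ∀ w, G.simpleGraph.Adj z w → ((u : ell2 m) : X → ℝ) w = 0 := by
    intro z hz
    have hs := key z hz
    have hn : ∀ w, 0 ≤ G.b z w * ((u : ell2 m) : X → ℝ) w :=
      fun w => mul_nonneg (G.b_nonneg _ _) (hu0 w)
    have h1 : (delta m y : X → ℝ) z * m z = 0 :=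
      le_antisymm (by linarith [hs.nonneg hn])
        (mul_nonneg (delta_nonneg m y z) (m.pos z).le)
    rw [h1, neg_zero, hasSum_zero_iff_of_nonneg hn] at hs
    refine ⟨(mul_eq_zero.1 h1).resolve_right (m.pos z).ne', fun w hw => ?_⟩
    exact (mul_eq_zero.1 (congrFun hs w)).resolve_left (ne_of_gt hw)
  have walk : ∀ z w, G.simpleGraph.Walk z w → ((u : ell2 m) : X → ℝ) z = 0 →
      ((u : ell2 m) : X → ℝ) w = 0 := by
    intro z w p
    induction p with
    | nil => exact id
    | cons h _ ih => exact fun hz => ih ((hzero _ hz).2 _ h)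
  refine lt_of_le_of_ne (hu0 x) fun hx => ?_
  obtain ⟨p, -⟩ := hG x y
  have := (hzero y (walk x y p hx.symm)).1
  rw [delta_self] at this
  exact one_ne_zero this

end GraphForms

/-! ### Transfer of resolvents, measures and forms along the order isomorphism -/

section Intertwining

variable {X₁ X₂ : Type*} {m₁ : FullMeasure X₁} {m₂ : FullMeasure X₂} {G₁ : WGraph X₁}
  {G₂ : WGraph X₂} {Q₁ : ClosedForm m₁} {Q₂ : ClosedForm m₂} {U : Ell2OrderIso m₁ m₂}

theorem Ell2OrderIso.Intertwines.map_resolvent (hU : U.Intertwines Q₁.generator Q₂.generator)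
    (hQ₁ : Q₁.IsAssociated G₁) (hQ₂ : Q₂.IsAssociated G₂) (f : ell2 m₁) :
    U (Q₁.resolvent f) = Q₂.resolvent (U f) := by
  have h1 : ((Q₁.resolvent f : ell2 m₁), f - Q₁.resolvent f) ∈ Q₁.generator.graph := by
    rw [hQ₁.generator_graph, Q₁.mem_generatorGraph_iff, add_sub_cancel]
  obtain ⟨a, ha, ha'⟩ := LinearPMap.mem_graph_iff _ |>.1 h1
  simp only at ha ha'
  have h2 : U (a : ell2 m₁) ∈ Q₂.generator.domain :=
    hU.1.subset (Set.mem_image_of_mem _ a.2)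
  have h3 := Q₂.generator.mem_graph ⟨U a, h2⟩
  rw [hQ₂.generator_graph, Q₂.mem_generatorGraph_iff, ← hU.2 a ⟨U a, h2⟩ rfl] at h3
  change U (a : ell2 m₁) = Q₂.resolvent (U (a : ell2 m₁) + U (Q₁.generator a)) at h3
  rwa [ha, ha', ← map_add, add_sub_cancel] at h3

theorem Ell2OrderIso.map_delta (U : Ell2OrderIso m₁ m₂) (y : X₂) :
    U (delta m₁ (U.bijection y)) = U.scaling y • delta m₂ y := by
  ext z
  rw [U.isRepresentedBy.2]
  by_cases hz : z = y
  · subst hz; simp [delta_self]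
  · simp [delta_ne m₂ hz, delta_ne m₁ (U.bijection.injective.ne hz)]

theorem Ell2OrderIso.exists_measure_eq (U : Ell2OrderIso m₁ m₂)
    (hU : U.Intertwines Q₁.generator Q₂.generator)
    (hQ₁ : Q₁.IsAssociated G₁) (hD₁ : Q₁.IsDirichlet) (hQ₂ : Q₂.IsAssociated G₂)
    (hconn : G₁.IsConnected) :
    ∃ β : ℝ, 0 < β ∧ ∀ w, m₁ (U.bijection w) = β * U.scaling w ^ 2 * m₂ w := by
  have hpos := U.isRepresentedBy.1
  rcases isEmpty_or_nonempty X₂ with h | ⟨⟨a⟩⟩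
  · exact ⟨1, one_pos, fun w => h.elim w⟩
  have key : ∀ a b : X₂, U.scaling a * ((Q₂.resolvent (delta m₂ a) : ell2 m₂) : X₂ → ℝ) b =
      U.scaling b * ((Q₁.resolvent (delta m₁ (U.bijection a)) : ell2 m₁) : X₁ → ℝ)
        (U.bijection b) := by
    intro a b
    rw [← U.isRepresentedBy.2, hU.map_resolvent hQ₁ hQ₂, U.map_delta, map_smul]
    rfl
  refine ⟨m₁ (U.bijection a) / (U.scaling a ^ 2 * m₂ a),
    div_pos (m₁.pos _) (mul_pos (pow_pos (hpos a) 2) (m₂.pos a)), fun w => ?_⟩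
  -- This kernel value is the factor to cancel; its positivity, due to connectedness, makes β
  -- independent of `w`.
  have hp := hQ₁.resolvent_delta_pos hD₁ hconn (U.bijection w) (U.bijection a)
  have e₁ := Q₁.resolvent_delta_comm (U.bijection a) (U.bijection w)
  have e₂ := Q₂.resolvent_delta_comm a w
  rw [div_mul_eq_mul_div, div_mul_eq_mul_div,
    eq_div_iff (mul_pos (pow_pos (hpos a) 2) (m₂.pos a)).ne']
  refine mul_left_cancel₀ hp.ne' ?_
  -- Symmetry of both kernels, with `key` used in both orders, eliminates the remaining kernel
  -- values.
  linear_combination U.scaling a ^ 2 * m₂ a * e₁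
    - m₁ (U.bijection a) * U.scaling a * m₂ a * key w a
    - m₁ (U.bijection a) * U.scaling a * U.scaling w * e₂
    + m₁ (U.bijection a) * U.scaling w * m₂ w * key a w

theorem Ell2OrderIso.ell2Form_eq (U : Ell2OrderIso m₁ m₂) {β : ℝ}
    (hβ : ∀ w, m₁ (U.bijection w) = β * U.scaling w ^ 2 * m₂ w) (f g : ell2 m₁) :
    ell2Form m₁ f g = β * ell2Form m₂ (U f) (U g) := by
  rw [ell2Form_apply, ell2Form_apply, ell2Inner, ell2Inner, ← tsum_mul_left,
    ← U.bijection.tsum_eq]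
  refine tsum_congr fun y => ?_
  rw [U.isRepresentedBy.2, U.isRepresentedBy.2, hβ]
  ring

/-- Both sides become resolvent inequalities. After substituting `U f` for the test vector, they
differ only by the factor β². -/
theorem Ell2OrderIso.Intertwines.formInner_le_iff (hU : U.Intertwines Q₁.generator Q₂.generator)
    (hQ₁ : Q₁.IsAssociated G₁) (hQ₂ : Q₂.IsAssociated G₂) {β : ℝ} (hβ : 0 < β)
    (hm : ∀ w, m₁ (U.bijection w) = β * U.scaling w ^ 2 * m₂ w) (v : ell2 m₁) {C : ℝ}
    (hC : 0 ≤ C) :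
    (∃ hv : v ∈ Q₁.domain, Q₁.formInner ⟨v, hv⟩ ⟨v, hv⟩ ≤ β * C) ↔
      ∃ hv : U v ∈ Q₂.domain, Q₂.formInner ⟨U v, hv⟩ ⟨U v, hv⟩ ≤ C := by
  rw [hQ₁.formInner_le_iff v (mul_nonneg hβ.le hC), hQ₂.formInner_le_iff (U v) hC,
    U.toEquiv.surjective.forall]
  refine forall_congr' fun f => ?_
  rw [U.ell2Form_eq hm f v, U.ell2Form_eq hm f (Q₁.resolvent f), hU.map_resolvent hQ₁ hQ₂,
    show β * C * (β * ell2Form m₂ (U f) (Q₂.resolvent (U f)))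
      = β ^ 2 * (C * ell2Form m₂ (U f) (Q₂.resolvent (U f))) by ring, mul_pow,
    mul_le_mul_iff_right₀ (pow_pos hβ 2)]

theorem Ell2OrderIso.Intertwines.map_mem_domain_iff
    (hU : U.Intertwines Q₁.generator Q₂.generator)
    (hQ₁ : Q₁.IsAssociated G₁) (hQ₂ : Q₂.IsAssociated G₂) {β : ℝ} (hβ : 0 < β)
    (hm : ∀ w, m₁ (U.bijection w) = β * U.scaling w ^ 2 * m₂ w) (v : ell2 m₁) :
    U v ∈ Q₂.domain ↔ v ∈ Q₁.domain := by
  constructor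
  · intro hv
    exact ((hU.formInner_le_iff hQ₁ hQ₂ hβ hm v (Q₂.formInner_self_nonneg ⟨U v, hv⟩)).2
      ⟨hv, le_rfl⟩).1
  · intro hv
    refine ((hU.formInner_le_iff hQ₁ hQ₂ hβ hm v
      (div_nonneg (Q₁.formInner_self_nonneg ⟨v, hv⟩) hβ.le)).1 ⟨hv, ?_⟩).1
    rw [mul_div_cancel₀ _ hβ.ne']

/-- Taking the optimal constant in each direction of `formInner_le_iff` gives equality of the form
norms up to β; the ℓ² parts then cancel. -/
theorem Ell2OrderIso.Intertwines.bilin_self_eq (hU : U.Intertwines Q₁.generator Q₂.generator)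
    (hQ₁ : Q₁.IsAssociated G₁) (hQ₂ : Q₂.IsAssociated G₂) {β : ℝ} (hβ : 0 < β)
    (hm : ∀ w, m₁ (U.bijection w) = β * U.scaling w ^ 2 * m₂ w) (v : Q₁.domain)
    (hv : U v ∈ Q₂.domain) : Q₁.bilin v v = β * Q₂.bilin ⟨U v, hv⟩ ⟨U v, hv⟩ := by
  have h1 := ((hU.formInner_le_iff hQ₁ hQ₂ hβ hm v (Q₂.formInner_self_nonneg ⟨U v, hv⟩)).2
      ⟨hv, le_rfl⟩).2
  have h2 := ((hU.formInner_le_iff hQ₁ hQ₂ hβ hm v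
      (div_nonneg (Q₁.formInner_self_nonneg v) hβ.le)).1 ⟨v.2, by
        rw [mul_div_cancel₀ _ hβ.ne']⟩).2
  rw [le_div_iff₀' hβ] at h2
  have h3 : Q₁.formInner v v = β * Q₂.formInner ⟨U v, hv⟩ ⟨U v, hv⟩ := le_antisymm h1 h2
  rw [Q₁.formInner_apply, Q₂.formInner_apply, mul_add, ← U.ell2Form_eq hm] at h3
  exact add_right_cancel h3

theorem Ell2OrderIso.Intertwines.bilin_eq (hU : U.Intertwines Q₁.generator Q₂.generator)
    (hQ₁ : Q₁.IsAssociated G₁) (hQ₂ : Q₂.IsAssociated G₂) {β : ℝ} (hβ : 0 < β)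
    (hm : ∀ w, m₁ (U.bijection w) = β * U.scaling w ^ 2 * m₂ w) (f g : Q₁.domain)
    (hf : U f ∈ Q₂.domain) (hg : U g ∈ Q₂.domain) :
    Q₁.bilin f g = β * Q₂.bilin ⟨U f, hf⟩ ⟨U g, hg⟩ := by
  have hfg : U ((f + g : Q₁.domain) : ell2 m₁) ∈ Q₂.domain :=
    (hU.map_mem_domain_iff hQ₁ hQ₂ hβ hm _).2 (f + g).2
  have h1 := hU.bilin_self_eq hQ₁ hQ₂ hβ hm (f + g) hfg
  have h2 : (⟨U ((f + g : Q₁.domain) : ell2 m₁), hfg⟩ : Q₂.domain) = ⟨U f, hf⟩ + ⟨U g, hg⟩ :=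
    Subtype.ext (map_add U.toEquiv _ _)
  rw [h2] at h1
  simp only [map_add, LinearMap.add_apply] at h1
  have h3 := hU.bilin_self_eq hQ₁ hQ₂ hβ hm f hf
  have h4 := hU.bilin_self_eq hQ₁ hQ₂ hβ hm g hg
  have h5 := Q₁.symm f g
  have h6 := Q₂.symm ⟨U f, hf⟩ ⟨U g, hg⟩
  rw [← h5, ← h6] at h1
  linarith

/-- The generalized forms of the two graphs on pairs of vertices. -/
theorem Ell2OrderIso.Intertwines.formalLaplacian_delta_eq
    (hU : U.Intertwines Q₁.generator Q₂.generator)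
    (hQ₁ : Q₁.IsAssociated G₁) (hQ₂ : Q₂.IsAssociated G₂) {β : ℝ} (hβ : 0 < β)
    (hm : ∀ w, m₁ (U.bijection w) = β * U.scaling w ^ 2 * m₂ w) (x y : X₂) :
    G₁.formalLaplacian (delta m₁ (U.bijection x) : X₁ → ℝ) (U.bijection y) =
      β * U.scaling x * U.scaling y * G₂.formalLaplacian (delta m₂ x : X₂ → ℝ) y := by
  have hd : ∀ z, U (delta m₁ (U.bijection z)) ∈ Q₂.domain := fun z =>
    (hU.map_mem_domain_iff hQ₁ hQ₂ hβ hm _).2 (hQ₁.delta_mem _)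
  have hs : ∀ z, (⟨U (delta m₁ (U.bijection z)), hd z⟩ : Q₂.domain) =
      U.scaling z • ⟨delta m₂ z, hQ₂.delta_mem z⟩ := fun z => Subtype.ext (U.map_delta z)
  have h := hU.bilin_eq hQ₁ hQ₂ hβ hm ⟨_, hQ₁.delta_mem (U.bijection x)⟩
    ⟨_, hQ₁.delta_mem (U.bijection y)⟩ (hd x) (hd y)
  rw [hQ₁.bilin_delta, hs, hs] at h
  simp only [map_smul, LinearMap.smul_apply, smul_eq_mul] at h
  rw [hQ₂.bilin_delta] at h
  rw [h]
  ring

end Intertwining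

end GraphDiffusion

/-! ### Recovering the graph data from the form identity -/

theorem theorem3p6 {X₁ X₂ : Type*} [Countable X₁] [Countable X₂]
    (m₁ : FullMeasure X₁) (m₂ : FullMeasure X₂) (G₁ : WGraph X₁) (G₂ : WGraph X₂)
    (Q₁ : ClosedForm m₁) (Q₂ : ClosedForm m₂)
    (hQ₁ : Q₁.IsAssociated G₁) (hD₁ : Q₁.IsDirichlet)
    (hQ₂ : Q₂.IsAssociated G₂) (hD₂ : Q₂.IsDirichlet)
    (hconn : G₁.IsConnected)
    (U : Ell2OrderIso m₁ m₂) (hU : U.Intertwines Q₁.generator Q₂.generator) :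
    U '' (Q₁.domain : Set (ell2 m₁)) = (Q₂.domain : Set (ell2 m₂)) ∧
    ∃ β : ℝ, 0 < β ∧
      (∀ (f g : Q₁.domain) (hf : U f ∈ Q₂.domain) (hg : U g ∈ Q₂.domain),
        Q₁.bilin f g = β * Q₂.bilin ⟨U f, hf⟩ ⟨U g, hg⟩) ∧
      (∀ w, m₁ (U.bijection w) = β * U.scaling w ^ 2 * m₂ w) ∧
      (∀ x y, G₁.b (U.bijection x) (U.bijection y) =
        β * U.scaling x * U.scaling y * G₂.b x y) ∧
      U.scaling ∈ G₂.formalDomain ∧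
      (∀ z, G₁.c (U.bijection z) =
        β * U.scaling z * G₂.formalLaplacian U.scaling z) := by
  obtain ⟨β, hβ, hm⟩ := U.exists_measure_eq hU hQ₁ hD₁ hQ₂ hconn
  have hpos := U.isRepresentedBy.1
  have hmem := hU.map_mem_domain_iff hQ₁ hQ₂ hβ hm
  have hL := hU.formalLaplacian_delta_eq hQ₁ hQ₂ hβ hm
  have hb : ∀ x y, G₁.b (U.bijection x) (U.bijection y) =
      β * U.scaling x * U.scaling y * G₂.b x y := by
    intro x y
    rcases eq_or_ne x y with rfl | hxy
    · rw [G₁.b_diag, G₂.b_diag, mul_zero]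
    · have h := hL y x
      rw [WGraph.formalLaplacian_delta_of_ne hxy,
        WGraph.formalLaplacian_delta_of_ne (U.bijection.injective.ne hxy)] at h
      linarith
  have hsum : ∀ x, Summable fun y => G₂.b x y * U.scaling y := by
    intro x
    -- By `hb`, summability of the rows of b₁ is that of b₂(x, ·) h, that is, h ∈ ℱ₂.
    have h := (((U.bijection.summable_iff).2 (G₁.b_summable (U.bijection x))).mul_left
      (β * U.scaling x)⁻¹)
    refine h.congr fun y => ?_
    rw [Function.comp_apply, hb, inv_mul_eq_div, div_eq_iff (mul_pos hβ (hpos x)).ne']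
    ring
  refine ⟨?_, β, hβ, hU.bilin_eq hQ₁ hQ₂ hβ hm, hm, hb, fun x => ?_, fun z => ?_⟩
  · ext g
    obtain ⟨f, rfl⟩ := U.toEquiv.surjective g
    constructor
    · rintro ⟨f', hf', h⟩
      rw [← h]
      exact (hmem f').2 hf'
    · exact fun hf => ⟨f, (hmem f).1 hf, rfl⟩
  · simpa only [abs_of_pos (hpos _)] using hsum x
  -- The diagonal entry is the total edge weight at the vertex plus c. Rewriting the weights of b₁
  -- through `hb` leaves c₁ on one side and β h ℒ₂h on the other.
  · have h := hL z z
    rw [WGraph.formalLaplacian_delta_self, WGraph.formalLaplacian_delta_self,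
      ← U.bijection.tsum_eq] at h
    have h1 : ∑' y, G₁.b (U.bijection z) (U.bijection y) =
        β * U.scaling z * ∑' y, G₂.b z y * U.scaling y := by
      rw [← tsum_mul_left]
      exact tsum_congr fun y => by rw [hb]; ring
    have h2 : ∑' y, G₂.b z y * (U.scaling z - U.scaling y) =
        (∑' y, G₂.b z y) * U.scaling z - ∑' y, G₂.b z y * U.scaling y := by
      rw [← tsum_mul_right, ← ((G₂.b_summable z).mul_right _).tsum_sub (hsum z)]
      exact tsum_congr fun y => by ring
    rw [h1] at h
    rw [WGraph.formalLaplacian, h2]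
    linear_combination h
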